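/- Let $\beta>3$, $w_0>0$ and $\lambda>0$ be constants and let $d=d(n)\in\mathbb{N}$ satisfy $d=\omega(\log n)$. For every $n$, let $G=G_n=\mathrm{GIRG}(n,\beta,w_0,d)$ be the following random graph with $n$ vertices (a standard geometric inhomogeneous random graph). Each vertex $v$ has a random weight $w_v$ with the Pareto distribution $\Pr[w_v\le x]=1-(x/w_0)^{1-\beta}$ for $x\ge w_0$, and a random position $\mathbf{x}_v$ uniformly distributed on the torus $\mathbb{T}^d=(\mathbb{R}/\mathbb{Z})^d$; all weights and positions are independent. Two vertices $u\ne v$ are adjacent if and only if $$\|\mathbf{x}_u-\mathbf{x}_v\|_\infty=\max_{1\le i\le d}|\mathbf{x}_{ui}-\mathbf{x}_{vi}|_C\;\le\;\frac12\left(\frac{\lambda w_uw_v}{n}\right)^{1/d},$$ where $|a-b|_C=\min\{|a-b|,1-|a-b|\}$ for $a,b\in[0,1)$ is the distance on the circle. Let $K_k$ be the number of cliques in $G$ on exactly $k$ vertices, and let $\omega(G)$ be the clique number of $G$. Then, as $n\to\infty$, $\mathbb{E}[K_k]=o(1)$ for $k\ge 4$, where $k$ is fixed or, more generally, $k=k(n)\ge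 4$ may be any function of $n$. Moreover, $\omega(G)\le 3$ asymptotically almost surely, that is, $\Pr[\omega(G)\le 3]\to 1$ as $n\to\infty$. -/

import Mathlib

open MeasureTheory ProbabilityTheory Filter Asymptotics
open scoped Topology ENNReal

noncomputable section

namespace GIRG

/-- The `d`-dimensional torus `(ℝ/ℤ)^d`. Its distance is the maximum over the coordinates of the
distance `min (|a - b|, 1 - |a - b|)` on the circle of circumference one (see `dist_coe_circle`),
and its `volume` is the uniform (Lebesgue) probability measure. -/
abbrev Torus (d : ℕ) : Type := Fin d → UnitAddCircle

/-- The distance on the circle between two points with representatives `a, b ∈ [0, 1]`. -/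
lemma dist_coe_circle (a b : ℝ) (ha : a ∈ Set.Icc (0 : ℝ) 1) (hb : b ∈ Set.Icc (0 : ℝ) 1) :
    dist (a : UnitAddCircle) (b : UnitAddCircle) = min |a - b| (1 - |a - b|) := by
  have key : ∀ t : ℝ, 0 ≤ t → t ≤ 1 → ‖(t : UnitAddCircle)‖ = min t (1 - t) := by
    intro t h0 h1
    rw [UnitAddCircle.norm_eq, abs_sub_round_eq_min]
    rcases h1.lt_or_eq with h | h
    · rw [Int.fract_eq_self.2 ⟨h0, h⟩]
    · subst h; simp
  rw [dist_eq_norm, ← AddCircle.coe_sub]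
  rcases le_total b a with h | h
  · rw [abs_of_nonneg (sub_nonneg.2 h)]
    exact key _ (sub_nonneg.2 h) (by linarith [ha.2, hb.1])
  · rw [← norm_neg, ← AddCircle.coe_neg, neg_sub, abs_sub_comm, abs_of_nonneg (sub_nonneg.2 h)]
    exact key _ (sub_nonneg.2 h) (by linarith [hb.2, ha.1])

/-- The data of `n` vertices: each has a weight and a position on the torus. -/
abbrev Config (n d : ℕ) : Type := Fin n → ℝ × Torus d

/-- The law of the vertex data: all weights and all positions are independent, the weights have the
Pareto distribution `ℙ(w ≤ x) = 1 - (x / w₀) ^ (1 - β)` for `x ≥ w₀`, that is, with scale `w₀` and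
shape `β - 1`, and the positions are uniform on the torus. -/
def law (n : ℕ) (β w₀ : ℝ) (d : ℕ) : Measure (Config n d) :=
  Measure.pi fun _ => (paretoMeasure w₀ (β - 1)).prod (volume : Measure (Torus d))

lemma isProbabilityMeasure_law (n : ℕ) {β w₀ : ℝ} (d : ℕ) (hβ : 1 < β) (hw₀ : 0 < w₀) :
    IsProbabilityMeasure (law n β w₀ d) := by
  have : IsProbabilityMeasure (paretoMeasure w₀ (β - 1)) :=
    isProbabilityMeasure_paretoMeasure hw₀ (by linarith)
  have : IsProbabilityMeasure (volume : Measure UnitAddCircle) :=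
    ⟨by simp⟩
  unfold law
  infer_instance

/-- The connection threshold `½ (lam * w_u * w_v / n) ^ (1 / d)`. -/
def threshold (lam : ℝ) (n d : ℕ) (a b : ℝ) : ℝ :=
  1 / 2 * (lam * a * b / n) ^ (1 / (d : ℝ))

/-- The geometric inhomogeneous random graph determined by the vertex data `ω`. -/
def graph (lam : ℝ) {n d : ℕ} (ω : Config n d) : SimpleGraph (Fin n) where
  Adj u v := u ≠ v ∧ dist (ω u).2 (ω v).2 ≤ threshold lam n d (ω u).1 (ω v).1
  symm := ⟨fun u v h => ⟨h.1.symm, by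
    have h2 := h.2
    rw [dist_comm, threshold, mul_right_comm] at h2
    exact h2⟩⟩
  loopless := ⟨fun _ h => h.1 rfl⟩

/-- The number of cliques on exactly `k` vertices. -/
def numCliques {V : Type*} (G : SimpleGraph V) (k : ℕ) : ℕ := (G.cliqueSet k).ncard

/-- The expected number of `k`-cliques. -/
def expectedCliques (lam : ℝ) (n : ℕ) (β w₀ : ℝ) (d k : ℕ) : ℝ≥0∞ :=
  ∫⁻ ω, (numCliques (graph lam ω) k : ℝ≥0∞) ∂(law n β w₀ d)

end GIRG

end

/-!
Conditionally on the weights, an edge `uv` is present if `u` and `v` are close in each of the `d`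
coordinates, which are independent. In each, this has probability `p = min 1 (a ^ (1 / d))`,
where `a = lam * w_u * w_v / n`. Differences of independent uniform points of the circle along
distinct pairs are pairwise independent, hence so are these events. As `d` grows faster than
`log n`, every `p` is close to one, and in this regime pairwise independence suffices: by Cantelli's
inequality for the number of events that occur, boundedly many of them occur simultaneously with
probability at most the product of the `p ^ c`, for any `c < 1`. Taking the `d`-th power, a clique
has conditional probability at most the product of the `a ^ c`, almost as if its edges were
independent.

A vertex of a clique on at least four vertices lies on at least three of its edges, so that it
contributes a factor `E[(√(lam / n) * w) ^ σ] = O(n ^ (-σ / 2))` for some `σ ∈ (2, 3)`. As there are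
at most `n` choices for each vertex, the expected number of cliques tends to zero. The bound needs
boundedly many edges, but a large vertex set splits into disjoint blocks of four to seven vertices,
which form cliques independently.
-/

namespace GIRG

section PairwiseIndependence

variable {Ω ι : Type*} [MeasurableSpace Ω] {μ : Measure Ω}

lemma indepFun_indicator_one {A B : Set Ω} (h : IndepSet A B μ) :
    IndepFun (A.indicator (1 : Ω → ℝ)) (B.indicator (1 : Ω → ℝ)) μ :=
  indep_of_indep_of_le h (MeasurableSpace.comap_indicator_const_le_generateFrom_singleton A 1)
    (MeasurableSpace.comap_indicator_const_le_generateFrom_singleton B 1)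

variable [IsProbabilityMeasure μ]

lemma memLp_indicator_one {A : Set Ω} (hA : MeasurableSet A) (p : ℝ≥0∞) :
    MemLp (A.indicator (1 : Ω → ℝ)) p μ :=
  memLp_indicator_const p hA 1 (Or.inr (measure_ne_top μ A))

lemma variance_indicator_one {A : Set Ω} (hA : MeasurableSet A) :
    variance (A.indicator (1 : Ω → ℝ)) μ = μ.real A * (1 - μ.real A) := by
  have hsq : A.indicator (1 : Ω → ℝ) ^ 2 = A.indicator 1 := by
    ext ω; by_cases hω : ω ∈ A <;> simp [hω]
  rw [variance_eq_sub (memLp_indicator_one hA 2), hsq, integral_indicator_one hA]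
  ring

-- Cantelli: apply Markov's inequality to the square of `X - μ[X] + Var[X] / t`
lemma measureReal_integral_add_le_le {X : Ω → ℝ} (hX : MemLp X 2 μ) {t : ℝ} (ht : 0 < t) :
    μ.real {ω | μ[X] + t ≤ X ω} ≤ variance X μ / (variance X μ + t ^ 2) := by
  set V := variance X μ
  have hV : 0 ≤ V := variance_nonneg X μ
  set Y : Ω → ℝ := fun ω => X ω + (V / t - μ[X])
  have hY : MemLp Y 2 μ := hX.add (memLp_const _)
  have hmean : μ[Y] = V / t := by
    rw [integral_add (hX.integrable one_le_two) (integrable_const _)]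
    simp
  have hsq : ∫ ω, Y ω ^ 2 ∂μ = V + (V / t) ^ 2 := by
    have hvar : variance Y μ = V := variance_add_const hX.aestronglyMeasurable _
    rw [variance_eq_sub hY, hmean] at hvar
    exact sub_eq_iff_eq_add.1 hvar
  have hsub : {ω | μ[X] + t ≤ X ω} ⊆ {ω | (t + V / t) ^ 2 ≤ Y ω ^ 2} := fun ω hω => by
    have hXω : μ[X] + t ≤ X ω := hω
    have hYω : t + V / t ≤ Y ω := by linarith
    exact pow_le_pow_left₀ (by positivity) hYω 2
  have hmarkov : (t + V / t) ^ 2 * μ.real {ω | (t + V / t) ^ 2 ≤ Y ω ^ 2} ≤ V + (V / t) ^ 2 :=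
    (mul_meas_ge_le_integral_of_nonneg (.of_forall fun _ => sq_nonneg _) hY.integrable_sq _).trans
      hsq.le
  calc μ.real {ω | μ[X] + t ≤ X ω}
      ≤ μ.real {ω | (t + V / t) ^ 2 ≤ Y ω ^ 2} := measureReal_mono hsub
    _ ≤ (V + (V / t) ^ 2) / (t + V / t) ^ 2 := (le_div_iff₀' (by positivity)).2 hmarkov
    _ = V / (V + t ^ 2) := by field_simp; ring

lemma measureReal_biInter_le_inv {E : Finset ι} {B : ι → Set Ω}
    (hB : ∀ i ∈ E, MeasurableSet (B i))
    (hindep : (E : Set ι).Pairwise fun i j => IndepSet (B i) (B j) μ) :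
    μ.real (⋂ i ∈ E, B i) ≤ (1 + ∑ i ∈ E, (1 - μ.real (B i)))⁻¹ := by
  set m := ∑ i ∈ E, (1 - μ.real (B i)) with hm
  obtain hm0 | hm0 : 0 = m ∨ 0 < m :=
    (Finset.sum_nonneg fun i _ => sub_nonneg.2 measureReal_le_one).eq_or_lt
  · simp [← hm0, measureReal_le_one]
  set N : Ω → ℝ := ∑ i ∈ E, (B i).indicator 1 with hN
  have hmean : μ[N] + m = E.card := by
    simp only [hN, Finset.sum_apply]
    rw [integral_finsetSum _ fun i hi => (memLp_indicator_one (hB i hi) 1).integrable le_rfl,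
      Finset.sum_congr rfl fun i hi => integral_indicator_one (hB i hi), hm,
      ← Finset.sum_add_distrib]
    simp
  have hvar : variance N μ ≤ m := by
    rw [hN, IndepFun.variance_sum (fun i hi => memLp_indicator_one (hB i hi) 2)
      (hindep.imp fun _ _ => indepFun_indicator_one)]
    refine Finset.sum_le_sum fun i hi => ?_
    rw [variance_indicator_one (hB i hi)]
    exact mul_le_of_le_one_left (sub_nonneg.2 measureReal_le_one) measureReal_le_one
  have hsub : ⋂ i ∈ E, B i ⊆ {ω | μ[N] + m ≤ N ω} := fun ω hω => by
    have hNω : N ω = E.card := by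
      rw [hN, Finset.sum_apply,
        Finset.sum_congr rfl fun i hi => Set.indicator_of_mem (Set.mem_iInter₂.1 hω i hi) _]
      simp
    exact (hmean.trans hNω.symm).le
  have hN2 : MemLp N 2 μ := memLp_finsetSum' _ fun i hi => memLp_indicator_one (hB i hi) 2
  calc μ.real (⋂ i ∈ E, B i)
      ≤ μ.real {ω | μ[N] + m ≤ N ω} := measureReal_mono hsub
    _ ≤ variance N μ / (variance N μ + m ^ 2) := measureReal_integral_add_le_le hN2 hm0
    _ ≤ m / (m + m ^ 2) := by
      rw [div_le_div_iff₀ (by positivity [variance_nonneg N μ]) (by positivity)]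
      nlinarith [sq_nonneg m]
    _ = (1 + m)⁻¹ := by field_simp

lemma measureReal_biInter_le_prod_rpow {E : Finset ι} {B : ι → Set Ω} {ε : ℝ}
    (hB : ∀ i ∈ E, MeasurableSet (B i))
    (hindep : (E : Set ι).Pairwise fun i j => IndepSet (B i) (B j) μ)
    (hε₀ : 0 ≤ ε) (hε₁ : ε < 1) (hBε : ∀ i ∈ E, 1 - ε ≤ μ.real (B i)) :
    μ.real (⋂ i ∈ E, B i) ≤ ∏ i ∈ E, μ.real (B i) ^ ((1 - ε) / (1 + E.card * ε)) := by
  set m := ∑ i ∈ E, (1 - μ.real (B i)) with hm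
  have hpos : ∀ i ∈ E, 0 < μ.real (B i) := fun i hi => (sub_pos.2 hε₁).trans_le (hBε i hi)
  have hm0 : 0 ≤ m := Finset.sum_nonneg fun i _ => sub_nonneg.2 measureReal_le_one
  have hmε : m ≤ E.card * ε := by
    rw [← nsmul_eq_mul]
    exact Finset.sum_le_card_nsmul _ _ _ fun i hi => sub_le_comm.1 (hBε i hi)
  have hlog : ∀ i ∈ E, -Real.log (μ.real (B i)) * (1 - ε) ≤ 1 - μ.real (B i) := fun i hi =>
    calc -Real.log (μ.real (B i)) * (1 - ε)
        ≤ ((μ.real (B i))⁻¹ - 1) * μ.real (B i) := by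
          gcongr
          · exact sub_nonneg.2 ((one_le_inv₀ (hpos i hi)).2 measureReal_le_one)
          · linarith [Real.one_sub_inv_le_log_of_pos (hpos i hi)]
          · exact hBε i hi
      _ = 1 - μ.real (B i) := by rw [sub_mul, inv_mul_cancel₀ (hpos i hi).ne', one_mul]
  calc μ.real (⋂ i ∈ E, B i)
      ≤ (1 + m)⁻¹ := measureReal_biInter_le_inv hB hindep
    _ = 1 - m / (1 + m) := by field_simp; ring
    _ ≤ Real.exp (-(m / (1 + m))) := Real.one_sub_le_exp_neg _
    _ ≤ Real.exp (∑ i ∈ E, Real.log (μ.real (B i)) * ((1 - ε) / (1 + E.card * ε))) := by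
      gcongr
      calc -(m / (1 + m)) ≤ -(m / (1 + E.card * ε)) := by gcongr
        _ ≤ -((∑ i ∈ E, -Real.log (μ.real (B i)) * (1 - ε)) / (1 + E.card * ε)) :=
          neg_le_neg (div_le_div_of_nonneg_right (Finset.sum_le_sum hlog) (by positivity))
        _ = ∑ i ∈ E, Real.log (μ.real (B i)) * ((1 - ε) / (1 + E.card * ε)) := by
          rw [Finset.sum_div, ← Finset.sum_neg_distrib]
          exact Finset.sum_congr rfl fun i _ => by ring
    _ = ∏ i ∈ E, μ.real (B i) ^ ((1 - ε) / (1 + E.card * ε)) := by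
      rw [Real.exp_sum]
      exact Finset.prod_congr rfl fun i hi => (Real.rpow_def_of_pos (hpos i hi) _).symm

end PairwiseIndependence

section ProductMeasure

lemma lintegral_pi_prod {ι α : Type*} [Fintype ι] [MeasurableSpace α] {μ : Measure α}
    [IsProbabilityMeasure μ] {f : α → ℝ≥0∞} (hf : Measurable f) (s : Finset ι) :
    ∫⁻ x, ∏ i ∈ s, f (x i) ∂(Measure.pi fun _ : ι => μ) = (∫⁻ a, f a ∂μ) ^ s.card := by
  have hindep : iIndepFun (fun (i : ι) (x : ι → α) => f (x i)) (Measure.pi fun _ : ι => μ) :=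
    iIndepFun_pi (X := fun _ => f) fun _ => hf.aemeasurable
  refine (lintegral_prod_eq_prod_lintegral_of_indepFun s _ hindep
    fun i => hf.comp (measurable_pi_apply i)).trans (Finset.prod_eq_pow_card fun i _ => ?_)
  exact (measurePreserving_eval (fun _ : ι => μ) i).lintegral_comp hf

end ProductMeasure

section UniformPoints

variable {G ι : Type*} [Fintype ι] [AddCommGroup G] [TopologicalSpace G]
  [IsTopologicalAddGroup G] [CompactSpace G] [SecondCountableTopology G] [MeasurableSpace G]
  [BorelSpace G] (μ : Measure G) [μ.IsAddHaarMeasure] [IsProbabilityMeasure μ]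

lemma measurePreserving_eval_sub_eval {u v : ι} (huv : u ≠ v) :
    MeasurePreserving (fun x : ι → G => x u - x v) (.pi fun _ => μ) μ := by
  classical
  let π := Pi.evalAddMonoidHom fun _ : ι => G
  let f : (ι → G) →+ G := π u - π v
  have hf : Continuous f := (continuous_apply u).sub (continuous_apply v)
  have hf_surj : Function.Surjective f := fun a => ⟨Pi.single u a, by simp [f, π, huv.symm]⟩
  exact f.measurePreserving hf hf_surj (by simp)

lemma measurePreserving_eval_sub_eval_prodMk {u v u' v' : ι} (huv : u ≠ v) (huv' : u' ≠ v')
    (hu : v' ≠ u) (hv : v' ≠ v) :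
    MeasurePreserving (fun x : ι → G => (x u - x v, x u' - x v')) (.pi fun _ => μ)
      (μ.prod μ) := by
  classical
  let π := Pi.evalAddMonoidHom fun _ : ι => G
  let f : (ι → G) →+ G × G := (π u - π v).prod (π u' - π v')
  have hf : Continuous f := ((continuous_apply u).sub (continuous_apply v)).prodMk
    ((continuous_apply u').sub (continuous_apply v'))
  have hf_surj : Function.Surjective f := by
    rintro ⟨a, b⟩
    let x : ι → G := Pi.single u a
    refine ⟨x + Pi.single v' (x u' - b), ?_⟩
    simp [f, π, x, huv.symm, huv', hu.symm, hv.symm, hu]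
  exact f.measurePreserving hf hf_surj (by simp)

lemma indepFun_eval_sub_eval {u v u' v' : ι} (huv : u ≠ v) (huv' : u' ≠ v')
    (hne : s(u, v) ≠ s(u', v')) :
    IndepFun (fun x : ι → G => x u - x v) (fun x => x u' - x v') (.pi fun _ => μ) := by
  wlog h : v' ≠ u ∧ v' ≠ v generalizing u' v'
  · have h' : u' ≠ u ∧ u' ≠ v := by
      simp only [ne_eq, Sym2.eq_iff] at hne
      grind
    have hswap := this huv'.symm (by rwa [Sym2.eq_swap (a := v')]) h'
    simpa [Function.comp_def] using hswap.comp measurable_id measurable_neg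
  have hsub := measurePreserving_eval_sub_eval μ huv
  have hsub' := measurePreserving_eval_sub_eval μ huv'
  rw [indepFun_iff_map_prod_eq_prod_map_map hsub.aemeasurable hsub'.aemeasurable, hsub.map_eq,
    hsub'.map_eq]
  exact (measurePreserving_eval_sub_eval_prodMk μ huv huv' h.1 h.2).map_eq

lemma measurePreserving_piSwap {κ : Type*} [Fintype κ] :
    MeasurePreserving (fun (x : ι → κ → G) j i => x i j) (.pi fun _ => .pi fun _ => μ)
      (.pi fun _ => .pi fun _ => μ) := by
  let f : (ι → κ → G) →+ (κ → ι → G) :=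
    { toFun := fun x j i => x i j, map_zero' := rfl, map_add' := fun _ _ => rfl }
  have hf : Continuous f := by
    change Continuous fun (x : ι → κ → G) j i => x i j
    fun_prop
  exact f.measurePreserving hf (fun y => ⟨fun i j => y j i, rfl⟩) (by simp)

end UniformPoints

section Circle

variable {ι : Type*}

instance : IsProbabilityMeasure (volume : Measure UnitAddCircle) := ⟨by simp⟩

lemma setOf_dist_le_eq_preimage (u v : ι) (t : ℝ) :
    {x : ι → UnitAddCircle | dist (x u) (x v) ≤ t} =
      (fun x : ι → UnitAddCircle => x u - x v) ⁻¹' Metric.closedBall 0 t := by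
  ext x
  simp [dist_eq_norm]

lemma setOf_forall_dist_le_eq_biInter (E : Finset (ι × ι)) (t : ι × ι → ℝ) :
    {x : ι → UnitAddCircle | ∀ e ∈ E, dist (x e.1) (x e.2) ≤ t e} =
      ⋂ e ∈ E, {x | dist (x e.1) (x e.2) ≤ t e} := by
  ext x
  simp

lemma measurableSet_forall_dist_le (E : Finset (ι × ι)) (t : ι × ι → ℝ) :
    MeasurableSet {x : ι → UnitAddCircle | ∀ e ∈ E, dist (x e.1) (x e.2) ≤ t e} := by
  rw [setOf_forall_dist_le_eq_biInter]
  exact Finset.measurableSet_biInter _ fun e _ => measurableSet_le (by fun_prop) (by fun_prop)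

variable [Fintype ι]

lemma measureReal_dist_le {u v : ι} (huv : u ≠ v) {t : ℝ} (ht : 0 ≤ t) :
    volume.real {x : ι → UnitAddCircle | dist (x u) (x v) ≤ t} = min 1 (2 * t) := by
  rw [setOf_dist_le_eq_preimage, volume_pi,
    (measurePreserving_eval_sub_eval volume huv).measureReal_preimage
      measurableSet_closedBall.nullMeasurableSet, measureReal_def, AddCircle.volume_closedBall,
    ENNReal.toReal_ofReal (by positivity)]

lemma indepSet_dist_le {u v u' v' : ι} (huv : u ≠ v) (huv' : u' ≠ v')
    (hne : s(u, v) ≠ s(u', v')) (t t' : ℝ) :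
    IndepSet {x : ι → UnitAddCircle | dist (x u) (x v) ≤ t}
      {x : ι → UnitAddCircle | dist (x u') (x v') ≤ t'} volume := by
  rw [setOf_dist_le_eq_preimage, setOf_dist_le_eq_preimage]
  exact (indepFun_iff_indepSet_preimage (by fun_prop) (by fun_prop)).1
    (indepFun_eval_sub_eval volume huv huv' hne) _ _ measurableSet_closedBall
    measurableSet_closedBall

lemma volume_forall_dist_le_eq_pow (d : ℕ) {E : Finset (ι × ι)} {t : ι × ι → ℝ}
    (ht : ∀ e ∈ E, 0 ≤ t e) :
    volume {x : ι → Torus d | ∀ e ∈ E, dist (x e.1) (x e.2) ≤ t e} =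
      volume {x : ι → UnitAddCircle | ∀ e ∈ E, dist (x e.1) (x e.2) ≤ t e} ^ d := by
  set Q : Set (ι → UnitAddCircle) := {x | ∀ e ∈ E, dist (x e.1) (x e.2) ≤ t e}
  have hQ : MeasurableSet Q := measurableSet_forall_dist_le E t
  have hpre : {x : ι → Torus d | ∀ e ∈ E, dist (x e.1) (x e.2) ≤ t e} =
      (fun (x : ι → Torus d) j i => x i j) ⁻¹' Set.univ.pi fun _ => Q := by
    ext x
    simp only [Set.mem_ofPred_eq, Set.mem_preimage, Set.mem_univ_pi, Q]
    exact ⟨fun h j e he => (dist_pi_le_iff (ht e he)).1 (h e he) j,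
      fun h e he => (dist_pi_le_iff (ht e he)).2 fun j => h j e he⟩
  have hswap : MeasurePreserving (fun (x : ι → Torus d) j i => x i j) volume volume :=
    measurePreserving_piSwap volume
  rw [hpre, hswap.measure_preimage (MeasurableSet.univ_pi fun _ => hQ).nullMeasurableSet,
    volume_pi, Measure.pi_pi, Finset.prod_const, Finset.card_univ, Fintype.card_fin]

end Circle

section Pairs

variable {V : Type*} [LinearOrder V]

/-- The pairs `(u, v)` of elements `u < v` of `s`, encoding the unordered pairs of distinct
elements of `s`, that is, the potential edges among these vertices. -/
def pairs (s : Finset V) : Finset (V × V) :=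
  (s ×ˢ s).filter fun e => e.1 < e.2

lemma mem_pairs {s : Finset V} {e : V × V} :
    e ∈ pairs s ↔ e.1 ∈ s ∧ e.2 ∈ s ∧ e.1 < e.2 := by
  rw [pairs, Finset.mem_filter, Finset.mem_product, and_assoc]

lemma card_pairs_le (s : Finset V) : (pairs s).card ≤ s.card ^ 2 :=
  (Finset.card_filter_le _ _).trans_eq (by rw [Finset.card_product, sq])

lemma sym2Mk_ne_of_mem_pairs {s : Finset V} {e e' : V × V} (he : e ∈ pairs s)
    (he' : e' ∈ pairs s) (hne : e ≠ e') : s(e.1, e.2) ≠ s(e'.1, e'.2) := by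
  have hlt := (mem_pairs.1 he).2.2
  have hlt' := (mem_pairs.1 he').2.2
  rw [ne_eq, Sym2.eq_iff]
  rintro (⟨h₁, h₂⟩ | ⟨h₁, h₂⟩)
  · exact hne (Prod.ext h₁ h₂)
  · exact hlt.asymm (h₁ ▸ h₂ ▸ hlt')

lemma prod_pairs {M : Type*} [CommMonoid M] (s : Finset V) (g : V → M) :
    ∏ e ∈ pairs s, g e.1 * g e.2 = ∏ u ∈ s, g u ^ (s.card - 1) := by
  have hsplit : ∀ u v, (if u < v then g u * g v else 1) =
      (if u < v then g u else 1) * (if u < v then g v else 1) := by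
    intro u v
    split_ifs <;> simp
  rw [pairs, Finset.prod_filter, Finset.prod_product]
  simp only [hsplit, Finset.prod_mul_distrib]
  rw [Finset.prod_comm (f := fun u v => if u < v then g v else 1), ← Finset.prod_mul_distrib]
  refine Finset.prod_congr rfl fun u hu => ?_
  rw [← Finset.prod_mul_distrib, ← Finset.card_erase_of_mem hu, ← Finset.prod_const,
    ← Finset.mul_prod_erase s _ hu]
  simp only [lt_irrefl, if_false, one_mul]
  refine Finset.prod_congr rfl fun v hv => ?_
  rcases lt_or_gt_of_ne (Finset.ne_of_mem_erase hv) with h | h <;> simp [h, h.not_gt]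

variable [Fintype V]

lemma measureReal_forall_pairs_dist_le (s : Finset V) {t : V × V → ℝ} {ε : ℝ} (hε₀ : 0 ≤ ε)
    (hε₁ : ε < 1) (ht : ∀ e ∈ pairs s, 1 - ε ≤ 2 * t e) :
    volume.real {x : V → UnitAddCircle | ∀ e ∈ pairs s, dist (x e.1) (x e.2) ≤ t e} ≤
      ∏ e ∈ pairs s, min 1 (2 * t e) ^ ((1 - ε) / (1 + (pairs s).card * ε)) := by
  have hprob : ∀ e ∈ pairs s, volume.real {x : V → UnitAddCircle | dist (x e.1) (x e.2) ≤ t e} =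
      min 1 (2 * t e) := fun e he =>
    measureReal_dist_le (mem_pairs.1 he).2.2.ne (by linarith [ht e he])
  have hindep : (pairs s : Set (V × V)).Pairwise fun e e' =>
      IndepSet {x : V → UnitAddCircle | dist (x e.1) (x e.2) ≤ t e}
        {x | dist (x e'.1) (x e'.2) ≤ t e'} volume := fun e he e' he' hne =>
    indepSet_dist_le (mem_pairs.1 he).2.2.ne (mem_pairs.1 he').2.2.ne
      (sym2Mk_ne_of_mem_pairs he he' hne) _ _
  have hbound := measureReal_biInter_le_prod_rpow
    (fun e _ => measurableSet_le (by fun_prop) (by fun_prop)) hindep hε₀ hε₁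
    fun e he => (le_min (by linarith) (ht e he)).trans_eq (hprob e he).symm
  rw [setOf_forall_dist_le_eq_biInter]
  exact hbound.trans_eq (Finset.prod_congr rfl fun e he => by rw [hprob e he])

lemma volume_forall_pairs_dist_le {d : ℕ} (hd : d ≠ 0) (s : Finset V) {a : V × V → ℝ} {ε c : ℝ}
    (hε₀ : 0 ≤ ε) (hε₁ : ε < 1) (ha : ∀ e ∈ pairs s, 0 < a e)
    (haε : ∀ e ∈ pairs s, 1 - ε ≤ a e ^ (1 / (d : ℝ))) (hc₀ : 0 ≤ c)
    (hc : c ≤ (1 - ε) / (1 + (pairs s).card * ε)) :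
    volume {x : V → Torus d | ∀ e ∈ pairs s,
      dist (x e.1) (x e.2) ≤ 1 / 2 * a e ^ (1 / (d : ℝ))} ≤
    ENNReal.ofReal (∏ e ∈ pairs s, a e ^ c) := by
  have hroot : ∀ e ∈ pairs s, 0 < a e ^ (1 / (d : ℝ)) := fun e he =>
    Real.rpow_pos_of_pos (ha e he) _
  have htwo : ∀ e, 2 * (1 / 2 * a e ^ (1 / (d : ℝ))) = a e ^ (1 / (d : ℝ)) := fun e => by ring
  have hcoord := measureReal_forall_pairs_dist_le s (t := fun e => 1 / 2 * a e ^ (1 / (d : ℝ)))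
    hε₀ hε₁ fun e he => (haε e he).trans_eq (htwo e).symm
  simp only [htwo] at hcoord
  have hfactor : ∀ e ∈ pairs s,
      (min 1 (a e ^ (1 / (d : ℝ))) ^ ((1 - ε) / (1 + (pairs s).card * ε))) ^ d ≤ a e ^ c :=
    fun e he => by
    have hmin : 0 < min 1 (a e ^ (1 / (d : ℝ))) := lt_min one_pos (hroot e he)
    calc (min 1 (a e ^ (1 / (d : ℝ))) ^ ((1 - ε) / (1 + (pairs s).card * ε))) ^ d
        ≤ (min 1 (a e ^ (1 / (d : ℝ))) ^ c) ^ d := by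
          gcongr ?_ ^ d
          exact Real.rpow_le_rpow_of_exponent_ge hmin (min_le_left _ _) hc
      _ ≤ ((a e ^ (1 / (d : ℝ))) ^ c) ^ d := by
          gcongr
          exact min_le_right _ _
      _ = a e ^ c := by
          rw [← Real.rpow_natCast, ← Real.rpow_mul (ha e he).le, ← Real.rpow_mul (ha e he).le]
          field_simp
  rw [volume_forall_dist_le_eq_pow d fun e he => mul_nonneg one_half_pos.le (hroot e he).le,
    ← ofReal_measureReal, ← ENNReal.ofReal_pow measureReal_nonneg]
  refine ENNReal.ofReal_le_ofReal ((pow_le_pow_left₀ measureReal_nonneg hcoord d).trans ?_)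
  rw [← Finset.prod_pow]
  refine Finset.prod_le_prod (fun e he => ?_) hfactor
  have := hroot e he
  positivity

end Pairs

section Graph

lemma threshold_comm (lam : ℝ) (n d : ℕ) (a b : ℝ) :
    threshold lam n d a b = threshold lam n d b a := by
  rw [threshold, threshold, mul_right_comm]

@[fun_prop]
lemma measurable_threshold (lam : ℝ) (n d : ℕ) {α : Type*} [MeasurableSpace α] {f g : α → ℝ}
    (hf : Measurable f) (hg : Measurable g) :
    Measurable fun x => threshold lam n d (f x) (g x) := by
  unfold threshold
  fun_prop

lemma one_le_numCliques {V : Type*} [Finite V] {G : SimpleGraph V} {k : ℕ}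
    (hk : k ≤ G.cliqueNum) : 1 ≤ numCliques G k := by
  obtain ⟨s, hs⟩ := G.exists_isNClique_cliqueNum
  obtain ⟨t, hts, ht⟩ := Finset.exists_subset_card_eq (hk.trans_eq hs.card_eq.symm)
  have hmem : t ∈ G.cliqueSet k := ⟨hs.isClique.subset (Finset.coe_subset.2 hts), ht⟩
  exact (Set.ncard_pos (Set.toFinite _)).2 ⟨t, hmem⟩

variable (lam : ℝ) {n d : ℕ}

lemma isClique_graph_iff (ω : Config n d) (s : Finset (Fin n)) :
    (graph lam ω).IsClique s ↔ ∀ e ∈ pairs s,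
      dist (ω e.1).2 (ω e.2).2 ≤ threshold lam n d (ω e.1).1 (ω e.2).1 := by
  refine ⟨fun h e he => ?_, fun h u hu v hv huv => ⟨huv, ?_⟩⟩
  · obtain ⟨hu, hv, huv⟩ := mem_pairs.1 he
    exact (h hu hv huv.ne).2
  · rcases huv.lt_or_gt with hlt | hlt
    · exact h (u, v) (mem_pairs.2 ⟨hu, hv, hlt⟩)
    · rw [dist_comm, threshold_comm]
      exact h (v, u) (mem_pairs.2 ⟨hv, hu, hlt⟩)

lemma setOf_isClique_eq_biInter (s : Finset (Fin n)) :
    {ω : Config n d | (graph lam ω).IsClique s} = ⋂ e ∈ pairs s,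
      {ω | dist (ω e.1).2 (ω e.2).2 ≤ threshold lam n d (ω e.1).1 (ω e.2).1} := by
  ext ω
  simp [isClique_graph_iff]

lemma measurableSet_isClique (s : Finset (Fin n)) :
    MeasurableSet {ω : Config n d | (graph lam ω).IsClique s} := by
  rw [setOf_isClique_eq_biInter]
  exact Finset.measurableSet_biInter _ fun e _ => measurableSet_le (by fun_prop) (by fun_prop)

lemma measurableSet_comap_isClique (s : Finset (Fin n)) :
    MeasurableSet[MeasurableSpace.comap (fun (ω : Config n d) (i : s) => ω i) inferInstance]
      {ω : Config n d | (graph lam ω).IsClique s} := by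
  refine ⟨⋂ e ∈ pairs (Finset.univ : Finset s),
    {z | dist (z e.1).2 (z e.2).2 ≤ threshold lam n d (z e.1).1 (z e.2).1},
    Finset.measurableSet_biInter _ fun e _ => measurableSet_le (by fun_prop) (by fun_prop), ?_⟩
  ext ω
  suffices (∀ u ∈ s, ∀ v ∈ s, u < v →
      dist (ω u).2 (ω v).2 ≤ threshold lam n d (ω u).1 (ω v).1) ↔ (graph lam ω).IsClique s by
    simpa [mem_pairs] using this
  rw [isClique_graph_iff]
  simp only [mem_pairs, Prod.forall, and_imp]
  exact forall_congr' fun u => forall_comm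

lemma numCliques_eq_sum_indicator (ω : Config n d) (k : ℕ) :
    (numCliques (graph lam ω) k : ℝ≥0∞) =
      ∑ s ∈ Finset.powersetCard k (Finset.univ : Finset (Fin n)),
        {ω : Config n d | (graph lam ω).IsClique s}.indicator 1 ω := by
  classical
  have hset : (graph lam ω).cliqueSet k =
      ((Finset.powersetCard k Finset.univ).filter fun s : Finset (Fin n) =>
        (graph lam ω).IsClique s : Finset (Finset (Fin n))) := by
    ext s
    simp [SimpleGraph.mem_cliqueSet_iff, SimpleGraph.isNClique_iff, and_comm]
  rw [numCliques, hset, Set.ncard_coe_finset, Finset.card_filter, Nat.cast_sum]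
  exact Finset.sum_congr rfl fun s _ => by simp [Set.indicator_apply]

lemma measurable_numCliques (k : ℕ) :
    Measurable fun ω : Config n d => (numCliques (graph lam ω) k : ℝ≥0∞) := by
  simp only [numCliques_eq_sum_indicator]
  exact Finset.measurable_fun_sum _ fun s _ =>
    measurable_one.indicator (measurableSet_isClique lam s)

lemma lintegral_numCliques_eq_sum (P : Measure (Config n d)) (k : ℕ) :
    ∫⁻ ω, (numCliques (graph lam ω) k : ℝ≥0∞) ∂P =
      ∑ s ∈ Finset.powersetCard k (Finset.univ : Finset (Fin n)),
        P {ω | (graph lam ω).IsClique s} := by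
  simp only [numCliques_eq_sum_indicator]
  rw [lintegral_finsetSum _ fun s _ => measurable_one.indicator (measurableSet_isClique lam s)]
  exact Finset.sum_congr rfl fun s _ => lintegral_indicator_one (measurableSet_isClique lam s)

lemma one_sub_lintegral_numCliques_le_measure_cliqueNum_le (P : Measure (Config n d))
    [IsProbabilityMeasure P] (r : ℕ) :
    1 - ∫⁻ ω, (numCliques (graph lam ω) (r + 1) : ℝ≥0∞) ∂P ≤
      P {ω | (graph lam ω).cliqueNum ≤ r} := by
  have hmarkov : P {ω | (graph lam ω).cliqueNum ≤ r}ᶜ ≤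
      ∫⁻ ω, (numCliques (graph lam ω) (r + 1) : ℝ≥0∞) ∂P :=
    meas_le_lintegral₀ (measurable_numCliques lam (r + 1)).aemeasurable fun ω hω => by
      have hlt : r < (graph lam ω).cliqueNum := not_le.1 hω
      exact Nat.one_le_cast.2 (one_le_numCliques hlt)
  rw [tsub_le_iff_right, ← measure_univ (μ := P), ← Set.union_compl_self]
  exact (measure_union_le _ _).trans (by gcongr)

variable {lam}

lemma lintegral_numCliques_le_pow {P : Measure (Config n d)} {k : ℕ} {F : ℝ≥0∞}
    (hF : ∀ s : Finset (Fin n), s.card = k → P {ω | (graph lam ω).IsClique s} ≤ F ^ k) :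
    ∫⁻ ω, (numCliques (graph lam ω) k : ℝ≥0∞) ∂P ≤ (n * F) ^ k := by
  rw [lintegral_numCliques_eq_sum]
  calc ∑ s ∈ Finset.powersetCard k (Finset.univ : Finset (Fin n)),
        P {ω | (graph lam ω).IsClique s}
      ≤ ∑ _ ∈ Finset.powersetCard k (Finset.univ : Finset (Fin n)), F ^ k :=
        Finset.sum_le_sum fun s hs => hF s (Finset.mem_powersetCard.1 hs).2
    _ = (n.choose k : ℝ≥0∞) * F ^ k := by simp
    _ ≤ (n * F) ^ k := by
      rw [mul_pow]
      gcongr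
      exact mod_cast Nat.choose_le_pow n k

end Graph

section VertexLaw

/-- The law of the vertex data for a general weight distribution `ν`: all weights and positions are
independent, the weights have law `ν` and the positions are uniform. -/
noncomputable def vertexLaw (n : ℕ) (ν : Measure ℝ) (d : ℕ) : Measure (Config n d) :=
  Measure.pi fun _ => ν.prod (volume : Measure (Torus d))

/-- The moment of order `σ` of the rescaled weight `√(lam / n) * w`, where `w` has law `ν`. The
edge parameter `lam * w_u * w_v / n` is the product of the rescaled weights of its endpoints. -/
noncomputable def rescaledMoment (lam : ℝ) (n : ℕ) (ν : Measure ℝ) (σ : ℝ) : ℝ≥0∞ :=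
  ∫⁻ w, ENNReal.ofReal ((√(lam / n) * w) ^ σ) ∂ν

variable {ν : Measure ℝ} [IsProbabilityMeasure ν] {lam : ℝ} {n d : ℕ}

instance : IsProbabilityMeasure (vertexLaw n ν d) := by
  unfold vertexLaw
  infer_instance

lemma vertexLaw_isClique_eq_lintegral (s : Finset (Fin n)) :
    vertexLaw n ν d {ω | (graph lam ω).IsClique s} =
      ∫⁻ w, volume {x : Fin n → Torus d | ∀ e ∈ pairs s,
          dist (x e.1) (x e.2) ≤ threshold lam n d (w e.1) (w e.2)}
        ∂(Measure.pi fun _ : Fin n => ν) := by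
  set S : Set ((Fin n → ℝ) × (Fin n → Torus d)) := ⋂ e ∈ pairs s,
    {p | dist (p.2 e.1) (p.2 e.2) ≤ threshold lam n d (p.1 e.1) (p.1 e.2)} with hS
  have hSmeas : MeasurableSet S :=
    Finset.measurableSet_biInter _ fun e _ => measurableSet_le (by fun_prop) (by fun_prop)
  have hpre : {ω : Config n d | (graph lam ω).IsClique s} =
      MeasurableEquiv.arrowProdEquivProdArrow ℝ (Torus d) (Fin n) ⁻¹' S := by
    rw [setOf_isClique_eq_biInter, hS]
    simp only [Set.preimage_iInter]
    rfl
  rw [hpre, vertexLaw, (measurePreserving_arrowProdEquivProdArrow ℝ (Torus d) (Fin n)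
    (fun _ => ν) fun _ => volume).measure_preimage hSmeas.nullMeasurableSet,
    Measure.prod_apply hSmeas]
  refine lintegral_congr fun w => ?_
  rw [← volume_pi]
  congr 1
  ext x
  simp [hS]

lemma prod_pairs_mul_div_rpow (hlam : 0 ≤ lam) {s : Finset (Fin n)} (hs : 2 ≤ s.card)
    {w : Fin n → ℝ} (hw : ∀ u ∈ s, 0 ≤ w u) (σ : ℝ) :
    ∏ e ∈ pairs s, (lam * w e.1 * w e.2 / n) ^ (σ / (s.card - 1 : ℕ)) =
      ∏ u ∈ s, (√(lam / n) * w u) ^ σ := by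
  have hcard : ((s.card - 1 : ℕ) : ℝ) ≠ 0 := by
    rw [Nat.cast_ne_zero]
    omega
  have hnonneg : ∀ u ∈ s, 0 ≤ √(lam / n) * w u := fun u hu =>
    mul_nonneg (Real.sqrt_nonneg _) (hw u hu)
  have hedge : ∀ e ∈ pairs s, (lam * w e.1 * w e.2 / n) ^ (σ / (s.card - 1 : ℕ)) =
      (√(lam / n) * w e.1) ^ (σ / (s.card - 1 : ℕ)) *
        (√(lam / n) * w e.2) ^ (σ / (s.card - 1 : ℕ)) := fun e he => by
    obtain ⟨hu, hv, -⟩ := mem_pairs.1 he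
    rw [← Real.mul_rpow (hnonneg _ hu) (hnonneg _ hv), mul_mul_mul_comm,
      Real.mul_self_sqrt (by positivity), mul_assoc, mul_div_right_comm]
  rw [Finset.prod_congr rfl hedge,
    prod_pairs s fun u => (√(lam / n) * w u) ^ (σ / (s.card - 1 : ℕ))]
  refine Finset.prod_congr rfl fun u hu => ?_
  rw [← Real.rpow_natCast, ← Real.rpow_mul (hnonneg u hu), div_mul_cancel₀ _ hcard]

lemma vertexLaw_isClique_le_pow {w₀ ε σ : ℝ} (hd : d ≠ 0) (hw₀ : 0 < w₀)
    (hν : ∀ᵐ w ∂ν, w₀ ≤ w) (hlam : 0 < lam) (hε₀ : 0 ≤ ε) (hε₁ : ε < 1)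
    (hε : 1 - ε ≤ (lam * w₀ * w₀ / n) ^ (1 / (d : ℝ))) (hσ₀ : 0 ≤ σ) {s : Finset (Fin n)}
    (hs : 2 ≤ s.card) (hσ : σ / (s.card - 1 : ℕ) ≤ (1 - ε) / (1 + s.card ^ 2 * ε)) :
    vertexLaw n ν d {ω | (graph lam ω).IsClique s} ≤ rescaledMoment lam n ν σ ^ s.card := by
  have hn : 0 < (n : ℝ) := by
    have hcard := s.card_le_univ
    rw [Fintype.card_fin] at hcard
    exact Nat.cast_pos.2 (by omega)
  have hall : ∀ᵐ w ∂(Measure.pi fun _ : Fin n => ν), ∀ u, w₀ ≤ w u := ae_all_iff.2 fun u =>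
    (Measure.quasiMeasurePreserving_eval (fun _ : Fin n => ν) u).ae hν
  have hpairs : ((pairs s).card : ℝ) ≤ s.card ^ 2 := mod_cast card_pairs_le s
  rw [vertexLaw_isClique_eq_lintegral, rescaledMoment, ← lintegral_pi_prod (by fun_prop)]
  refine lintegral_mono_ae (hall.mono fun w hw => ?_)
  have hw_pos : ∀ u, 0 < w u := fun u => hw₀.trans_le (hw u)
  have hedge : ∀ e ∈ pairs s, lam * w₀ * w₀ / n ≤ lam * w e.1 * w e.2 / n := fun e _ => by
    have := hw_pos e.1
    gcongr <;> apply hw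
  rw [← ENNReal.ofReal_prod_of_nonneg fun u _ => by have := hw_pos u; positivity,
    ← prod_pairs_mul_div_rpow hlam.le hs fun u _ => (hw_pos u).le]
  refine volume_forall_pairs_dist_le hd s hε₀ hε₁ (fun e he => ?_) (fun e he => ?_)
    (by positivity) (hσ.trans ?_)
  · exact lt_of_lt_of_le (by positivity) (hedge e he)
  · exact hε.trans (Real.rpow_le_rpow (by positivity) (hedge e he) (by positivity))
  · have := sub_pos.2 hε₁
    gcongr

lemma vertexLaw_isClique_inter {s t : Finset (Fin n)} (hst : Disjoint s t) :
    vertexLaw n ν d ({ω | (graph lam ω).IsClique s} ∩ {ω | (graph lam ω).IsClique t}) =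
      vertexLaw n ν d {ω | (graph lam ω).IsClique s} *
        vertexLaw n ν d {ω | (graph lam ω).IsClique t} := by
  have hindep : iIndepFun (fun (i : Fin n) (ω : Config n d) => ω i) (vertexLaw n ν d) :=
    iIndepFun_pi (X := fun _ x => x) fun _ => by fun_prop
  have hst' := hindep.indepFun_finset s t hst fun i => by fun_prop
  exact hst'.meas_inter (measurableSet_comap_isClique lam s) (measurableSet_comap_isClique lam t)

lemma vertexLaw_isClique_le_pow_of_card_lt_two_mul {m : ℕ} {F : ℝ≥0∞} (hm : 0 < m)
    (hF : ∀ s : Finset (Fin n), m ≤ s.card → s.card < 2 * m →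
      vertexLaw n ν d {ω | (graph lam ω).IsClique s} ≤ F ^ s.card)
    {s : Finset (Fin n)} (hs : m ≤ s.card) :
    vertexLaw n ν d {ω | (graph lam ω).IsClique s} ≤ F ^ s.card := by
  induction s using Finset.strongInduction with
  | H s ih =>
    rcases lt_or_ge s.card (2 * m) with hlt | hge
    · exact hF s hs hlt
    obtain ⟨t, hts, ht⟩ := Finset.exists_subset_card_eq hs
    have hcard := Finset.card_sdiff_add_card_eq_card hts
    have hsdiff := ih (s \ t) (Finset.sdiff_ssubset hts (Finset.card_pos.1 (by omega))) (by omega)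
    calc vertexLaw n ν d {ω | (graph lam ω).IsClique s}
        ≤ vertexLaw n ν d ({ω | (graph lam ω).IsClique (s \ t : Finset (Fin n))} ∩
          {ω | (graph lam ω).IsClique t}) :=
          measure_mono fun ω hω => ⟨hω.subset (by simp), hω.subset (by simpa using hts)⟩
      _ ≤ F ^ (s \ t).card * F ^ t.card := by
        rw [vertexLaw_isClique_inter Finset.sdiff_disjoint]
        exact mul_le_mul' hsdiff (hF t (by omega) (by omega))
      _ = F ^ s.card := by rw [← pow_add, hcard]

end VertexLaw

section Asymptotics

lemma tendsto_natCast_atTop_of_log_isLittleO {d : ℕ → ℕ}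
    (hd : (fun n : ℕ => Real.log n) =o[atTop] fun n : ℕ => (d n : ℝ)) :
    Tendsto (fun n => (d n : ℝ)) atTop atTop := by
  have hlog : Tendsto (fun n : ℕ => ‖Real.log n‖) atTop atTop := tendsto_norm_atTop_atTop.comp
    (Real.tendsto_log_atTop.comp tendsto_natCast_atTop_atTop)
  simpa using hd.isBigO.trans_tendsto_norm_atTop hlog

lemma tendsto_div_rpow_one_div {d : ℕ → ℕ} {a : ℝ} (ha : 0 < a)
    (hd : (fun n : ℕ => Real.log n) =o[atTop] fun n : ℕ => (d n : ℝ)) :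
    Tendsto (fun n : ℕ => (a / n) ^ (1 / (d n : ℝ))) atTop (𝓝 1) := by
  have hexp : Tendsto (fun n : ℕ => Real.log a / d n - Real.log n / d n) atTop (𝓝 (0 - 0)) :=
    ((tendsto_natCast_atTop_of_log_isLittleO hd).const_div_atTop _).sub hd.tendsto_div_nhds_zero
  rw [sub_zero] at hexp
  have hlim := (Real.continuous_exp.tendsto 0).comp hexp
  rw [Real.exp_zero] at hlim
  refine hlim.congr' ?_
  filter_upwards [eventually_gt_atTop 0] with n hn
  have hn' : (0 : ℝ) < n := Nat.cast_pos.2 hn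
  rw [Function.comp_apply, Real.rpow_def_of_pos (by positivity), Real.log_div ha.ne' hn'.ne',
    mul_one_div, sub_div]

lemma lintegral_rpow_ne_top_of_le {ν : Measure ℝ} {w₀ σ τ : ℝ} (hw₀ : 0 < w₀)
    (hν : ∀ᵐ w ∂ν, w₀ ≤ w) (hστ : σ ≤ τ) (hτ : ∫⁻ w, ENNReal.ofReal (w ^ τ) ∂ν ≠ ∞) :
    ∫⁻ w, ENNReal.ofReal (w ^ σ) ∂ν ≠ ∞ := by
  refine ne_top_of_le_ne_top (ENNReal.mul_ne_top ENNReal.ofReal_ne_top hτ)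
    ((lintegral_mono_ae (hν.mono fun w hw => ?_)).trans_eq
      (lintegral_const_mul (ENNReal.ofReal (w₀ ^ (σ - τ))) (by fun_prop)))
  have hw_pos : 0 < w := hw₀.trans_le hw
  rw [← ENNReal.ofReal_mul (by positivity)]
  refine ENNReal.ofReal_le_ofReal ?_
  calc w ^ σ = w ^ (σ - τ) * w ^ τ := by rw [← Real.rpow_add hw_pos, sub_add_cancel]
    _ ≤ w₀ ^ (σ - τ) * w ^ τ := by
      gcongr ?_ * _
      exact Real.rpow_le_rpow_of_nonpos hw₀ hw (sub_nonpos.2 hστ)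

lemma rescaledMoment_eq {ν : Measure ℝ} (hν : ∀ᵐ w ∂ν, 0 ≤ w) {lam : ℝ} (hlam : 0 ≤ lam)
    (n : ℕ) (σ : ℝ) :
    rescaledMoment lam n ν σ =
      ENNReal.ofReal ((lam / n) ^ (σ / 2)) * ∫⁻ w, ENNReal.ofReal (w ^ σ) ∂ν := by
  rw [rescaledMoment, ← lintegral_const_mul _ (by fun_prop)]
  refine lintegral_congr_ae (hν.mono fun w hw => ?_)
  have hquot : 0 ≤ lam / n := by positivity
  simp only
  rw [Real.mul_rpow (Real.sqrt_nonneg _) hw, ENNReal.ofReal_mul (by positivity),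
    Real.sqrt_eq_rpow, ← Real.rpow_mul hquot, one_div_mul_eq_div]

lemma tendsto_mul_rescaledMoment {ν : Measure ℝ} (hν : ∀ᵐ w ∂ν, 0 ≤ w) {lam σ : ℝ}
    (hlam : 0 ≤ lam) (hσ : 2 < σ) (hmoment : ∫⁻ w, ENNReal.ofReal (w ^ σ) ∂ν ≠ ∞) :
    Tendsto (fun n : ℕ => (n : ℝ≥0∞) * rescaledMoment lam n ν σ) atTop (𝓝 0) := by
  have hpow : Tendsto (fun n : ℕ => lam ^ (σ / 2) * (n : ℝ) ^ (-(σ / 2 - 1))) atTop (𝓝 0) := by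
    rw [← mul_zero (lam ^ (σ / 2))]
    exact ((tendsto_rpow_neg_atTop (by linarith)).comp tendsto_natCast_atTop_atTop).const_mul _
  have hlim := ENNReal.Tendsto.mul_const (ENNReal.tendsto_ofReal hpow) (Or.inr hmoment)
  rw [ENNReal.ofReal_zero, zero_mul] at hlim
  refine hlim.congr' ?_
  filter_upwards [eventually_gt_atTop 0] with n hn
  have hn' : (0 : ℝ) < n := Nat.cast_pos.2 hn
  rw [rescaledMoment_eq hν hlam, ← mul_assoc, ← ENNReal.ofReal_natCast,
    ← ENNReal.ofReal_mul hn'.le, Real.div_rpow hlam hn'.le, neg_sub, Real.rpow_sub hn',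
    Real.rpow_one]
  congr 2
  ring

lemma eventually_vertexLaw_isClique_le_pow {ν : Measure ℝ} [IsProbabilityMeasure ν]
    {w₀ lam σ : ℝ} (hw₀ : 0 < w₀) (hν : ∀ᵐ w ∂ν, w₀ ≤ w) (hlam : 0 < lam) (hσ₀ : 0 ≤ σ)
    {d : ℕ → ℕ} (hd : (fun n : ℕ => Real.log n) =o[atTop] fun n : ℕ => (d n : ℝ)) {m : ℕ}
    (hσm : σ < (m - 1 : ℕ)) :
    ∀ᶠ n : ℕ in atTop, ∀ s : Finset (Fin n), m ≤ s.card →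
      vertexLaw n ν (d n) {ω | (graph lam ω).IsClique s} ≤ rescaledMoment lam n ν σ ^ s.card := by
  have hm₁ : (0 : ℝ) < (m - 1 : ℕ) := hσ₀.trans_lt hσm
  have hm : 2 ≤ m := by
    have := Nat.cast_pos.1 hm₁
    omega
  have hε : ∀ᶠ ε : ℝ in 𝓝[>] 0, ε < 1 ∧ σ / (m - 1 : ℕ) < (1 - ε) / (1 + (2 * m) ^ 2 * ε) := by
    have hlim : Tendsto (fun ε : ℝ => (1 - ε) / (1 + (2 * m) ^ 2 * ε)) (𝓝 0) (𝓝 1) := by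
      have hcont : ContinuousAt (fun ε : ℝ => (1 - ε) / (1 + (2 * m) ^ 2 * ε)) 0 := by
        fun_prop (disch := simp)
      simpa [ContinuousAt] using hcont
    exact nhdsWithin_le_nhds
      ((eventually_lt_nhds one_pos).and (hlim.eventually_const_lt ((div_lt_one hm₁).2 hσm)))
  obtain ⟨ε, ⟨hε₁, hσε⟩, hε₀ : 0 < ε⟩ := (hε.and self_mem_nhdsWithin).exists
  filter_upwards [(tendsto_div_rpow_one_div (a := lam * w₀ * w₀) (by positivity)
      hd).eventually_const_le (sub_lt_self 1 hε₀),
    (tendsto_natCast_atTop_of_log_isLittleO hd).eventually_gt_atTop 0] with n hroot hdn s hs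
  refine vertexLaw_isClique_le_pow_of_card_lt_two_mul (by omega) (fun t ht ht' => ?_) hs
  refine vertexLaw_isClique_le_pow (Nat.cast_pos.1 hdn).ne' hw₀ hν hlam hε₀.le hε₁ hroot hσ₀
    (hm.trans ht) ?_
  have := sub_pos.2 hε₁
  calc σ / (t.card - 1 : ℕ) ≤ σ / (m - 1 : ℕ) := by gcongr
    _ ≤ (1 - ε) / (1 + (2 * m) ^ 2 * ε) := hσε.le
    _ ≤ (1 - ε) / (1 + t.card ^ 2 * ε) := by
      gcongr
      exact mod_cast ht'.le

lemma tendsto_lintegral_numCliques {ν : Measure ℝ} [IsProbabilityMeasure ν] {w₀ lam σ : ℝ}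
    (hw₀ : 0 < w₀) (hν : ∀ᵐ w ∂ν, w₀ ≤ w) (hlam : 0 < lam) (hσ : 2 < σ)
    (hmoment : ∫⁻ w, ENNReal.ofReal (w ^ σ) ∂ν ≠ ∞) {d : ℕ → ℕ}
    (hd : (fun n : ℕ => Real.log n) =o[atTop] fun n : ℕ => (d n : ℝ)) {m : ℕ}
    (hσm : σ < (m - 1 : ℕ)) {k : ℕ → ℕ} (hk : ∀ n, m ≤ k n) :
    Tendsto (fun n : ℕ => ∫⁻ ω, (numCliques (graph lam ω) (k n) : ℝ≥0∞) ∂vertexLaw n ν (d n))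
      atTop (𝓝 0) := by
  have hfactor := tendsto_mul_rescaledMoment (hν.mono fun w hw => hw₀.le.trans hw) hlam.le hσ
    hmoment
  refine tendsto_of_tendsto_of_tendsto_of_le_of_le' tendsto_const_nhds hfactor
    (.of_forall fun _ => zero_le) ?_
  filter_upwards [eventually_vertexLaw_isClique_le_pow hw₀ hν hlam (by linarith) hd hσm,
    hfactor.eventually_le_const one_pos] with n hclique hle
  have hm₁ : 0 < m - 1 := Nat.cast_pos.1 ((two_pos.trans hσ).trans hσm)
  have hk_ne : k n ≠ 0 := by
    have := hk n
    omega
  calc ∫⁻ ω, (numCliques (graph lam ω) (k n) : ℝ≥0∞) ∂vertexLaw n ν (d n)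
      ≤ (n * rescaledMoment lam n ν σ) ^ k n :=
        lintegral_numCliques_le_pow fun s hs => (hclique s (hs ▸ hk n)).trans_eq (by rw [hs])
    _ ≤ n * rescaledMoment lam n ν σ :=
        pow_le_of_le_one zero_le hle hk_ne

end Asymptotics

section Pareto

lemma lintegral_rpow_paretoMeasure_ne_top {w₀ r τ : ℝ} (hw₀ : 0 < w₀) (hτ : τ < r) :
    ∫⁻ x, ENNReal.ofReal (x ^ τ) ∂(paretoMeasure w₀ r) ≠ ∞ := by
  have hdensity : Measurable (paretoPDF w₀ r) := (measurable_paretoPDFReal w₀ r).ennreal_ofReal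
  have hint : IntegrableOn (fun x : ℝ => r * w₀ ^ r * x ^ (-(r + 1) + τ)) (Set.Ici w₀) :=
    ((integrableOn_Ici_iff_integrableOn_Ioi (μ := volume)).2
      (integrableOn_Ioi_rpow_of_lt (by linarith) hw₀)).const_mul _
  rw [paretoMeasure, lintegral_withDensity_eq_lintegral_mul _ hdensity (by fun_prop)]
  refine ((lintegral_mono fun x => ?_).trans_lt
    (hint.integrable_indicator measurableSet_Ici).lintegral_lt_top).ne
  by_cases hx : w₀ ≤ x
  · have hx_pos : 0 < x := hw₀.trans_le hx
    rw [Set.indicator_of_mem (Set.mem_Ici.2 hx), Pi.mul_apply, paretoPDF_of_le hx,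
      ← ENNReal.ofReal_mul' (by positivity), mul_assoc, ← Real.rpow_add hx_pos]
  · rw [Pi.mul_apply, paretoPDF_of_lt (not_le.1 hx), zero_mul]
    exact zero_le

lemma ae_le_paretoMeasure (w₀ r : ℝ) : ∀ᵐ x ∂(paretoMeasure w₀ r), w₀ ≤ x := by
  have hset : {x | ¬ w₀ ≤ x} = Set.Iio w₀ := by
    ext
    simp
  rw [ae_iff, hset, paretoMeasure, withDensity_apply _ measurableSet_Iio,
    lintegral_paretoPDF_of_le le_rfl]

end Pareto

end GIRG

theorem mainTheorem6_general {ν : Measure ℝ} [IsProbabilityMeasure ν] {w₀ τ lam : ℝ}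
    (hw₀ : 0 < w₀) (hν : ∀ᵐ w ∂ν, w₀ ≤ w) (hτ : 2 < τ)
    (hmoment : ∫⁻ w, ENNReal.ofReal (w ^ τ) ∂ν ≠ ∞) (hlam : 0 < lam)
    {d : ℕ → ℕ} (hd : (fun n : ℕ => Real.log n) =o[atTop] (fun n : ℕ => (d n : ℝ))) :
    (∀ k : ℕ → ℕ, (∀ n, 4 ≤ k n) →
      Tendsto (fun n : ℕ => ∫⁻ ω, (GIRG.numCliques (GIRG.graph lam ω) (k n) : ℝ≥0∞)
        ∂GIRG.vertexLaw n ν (d n)) atTop (𝓝 0)) ∧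
    Tendsto (fun n : ℕ => GIRG.vertexLaw n ν (d n)
      {ω | (GIRG.graph lam ω).cliqueNum ≤ 3}) atTop (𝓝 1) := by
  -- `σ > 2` makes `n * (lam / n) ^ (σ / 2)` vanish; `σ < 3` leaves slack below the three edges that
  -- each vertex of a `4`-clique contributes.
  obtain ⟨σ, hσ, hστ⟩ := exists_between (lt_min hτ (by norm_num : (2 : ℝ) < 3))
  have hmomentσ := GIRG.lintegral_rpow_ne_top_of_le hw₀ hν (hστ.le.trans (min_le_left _ _)) hmoment
  have hσ3 : σ < (4 - 1 : ℕ) := by exact_mod_cast hστ.trans_le (min_le_right _ _)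
  have hcliques (k : ℕ → ℕ) (hk : ∀ n, 4 ≤ k n) :=
    GIRG.tendsto_lintegral_numCliques hw₀ hν hlam hσ hmomentσ hd hσ3 hk
  refine ⟨hcliques, tendsto_of_tendsto_of_tendsto_of_le_of_le ?_ tendsto_const_nhds
    (fun _ => GIRG.one_sub_lintegral_numCliques_le_measure_cliqueNum_le lam _ 3)
    fun _ => prob_le_one⟩
  simpa using ENNReal.Tendsto.sub tendsto_const_nhds (hcliques (fun _ => 4) fun _ => le_rfl)
    (Or.inl ENNReal.one_ne_top)

theorem mainTheorem6 (β w₀ lam : ℝ) (hβ : 3 < β) (hw₀ : 0 < w₀) (hlam : 0 < lam)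
    (d : ℕ → ℕ) (hd : (fun n : ℕ => Real.log n) =o[atTop] (fun n : ℕ => (d n : ℝ))) :
    (∀ k : ℕ → ℕ, (∀ n, 4 ≤ k n) →
      Tendsto (fun n : ℕ => GIRG.expectedCliques lam n β w₀ (d n) (k n)) atTop (𝓝 0)) ∧
    Tendsto (fun n : ℕ => GIRG.law n β w₀ (d n)
      {ω | (GIRG.graph lam ω).cliqueNum ≤ 3}) atTop (𝓝 1) := by
  have := isProbabilityMeasure_paretoMeasure hw₀ (by linarith : 0 < β - 1)
  obtain ⟨τ, hτ, hτβ⟩ := exists_between (by linarith : 2 < β - 1)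
  exact mainTheorem6_general hw₀ (GIRG.ae_le_paretoMeasure w₀ _) hτ
    (GIRG.lintegral_rpow_paretoMeasure_ne_top hw₀ hτβ) hlam hd
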